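/- **Terms and triples.** Let $\mathbf U$ (URI references) and $\mathbf L$ (literals, each plain or typed) be disjoint, with $\mathbf U$ containing the reserved vocabulary $\rho df_\bot=\{\mathsf{sp},\mathsf{sc},\mathsf{type},\mathsf{dom},\mathsf{range},\bot_c,\bot_p\}$. A triple $(s,p,o)$ has $p\in\mathbf U$ and $s,o\in(\mathbf U\cup\mathbf L)\setminus\rho df_\bot$; a graph is a set of triples; $\mathrm{uni}(G)$ is the set of terms occurring in $G$. A defeasible triple $\langle s,e,o\rangle$ has $e\in\{\mathsf{sc},\mathsf{sp}\}$ and $s,o\notin\rho df_\bot$. A defeasible graph $G=G^{str}\cup G^{def}$ consists of a finite set $G^{str}$ of triples and a finite set $G^{def}$ of defeasible triples. For a set $D$ of defeasible triples, $D^s=\{(s,e,o)\mid\langle s,e,o\rangle\in D\}$, and $G^s=G^{str}\cup (G^{def})^s$. **Deduction.** $G\vdash H$ means that $H$ is reached from $G$ by finitely many steps, each of which passes to a subset or adds the conclusion of an instance (all of whose members are triples) of one of the rules: $(A,\mathsf{sp},B),(B,\mathsf{sp},C)/(A,\mathsf{sp},C)$; $(D,\mathsf{sp},E),(X,D,Y)/(X,E,Y)$;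 $(A,\mathsf{sc},B),(B,\mathsf{sc},C)/(A,\mathsf{sc},C)$; $(A,\mathsf{sc},B),(X,\mathsf{type},A)/(X,\mathsf{type},B)$; $(D,\mathsf{dom},B),(X,D,Y)/(X,\mathsf{type},B)$; $(D,\mathsf{range},B),(X,D,Y)/(Y,\mathsf{type},B)$; for $(\bot,e)\in\{(\bot_c,\mathsf{sc}),(\bot_p,\mathsf{sp})\}$: $(A,\bot,B)/(B,\bot,A)$, $\;(A,\bot,B),(C,e,A)/(C,\bot,B)$, $\;(A,\bot,A)/(A,\bot,B)$; for $e\in\{\mathsf{dom},\mathsf{range}\}$: $(A,e,C),(B,e,D),(C,\bot_c,D)/(A,\bot_p,B)$. $\mathrm{Cl}(G)$ is the closure of $G$ under these rules. **Interpretations.** An interpretation $\mathcal I$ over a vocabulary $V$ has domains (possibly empty) $\Delta_R$, $\Delta_P$, $\Delta_C\subseteq\Delta_R$, $\Delta_L\subseteq\Delta_R$ with $\mathbf L\cap V\subseteq\Delta_L$, extensions $P[\![\cdot]\!]\colon\Delta_P\to2^{\Delta_R\times\Delta_R}$ and $C[\![\cdot]\!]\colon\Delta_C\to2^{\Delta_R}$,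 and a map $t\mapsto t^{\mathcal I}$ from $V$ to $\Delta_R\cup\Delta_P$ that fixes plain literals and sends literals into $\Delta_R$. For $e\in\rho df_\bot$ write $e(x,y)$ for $(x,y)\in P[\![e^{\mathcal I}]\!]$. $\mathcal I$ is a model of a graph $H$ ($\mathcal I\Vdash H$) if $\rho df_\bot\cup\mathrm{uni}(H)\subseteq V$ and: (1) $p^{\mathcal I}\in\Delta_P$ and $(s^{\mathcal I},o^{\mathcal I})\in P[\![p^{\mathcal I}]\!]$ for all $(s,p,o)\in H$; $e^{\mathcal I}\in\Delta_P$ for all $e\in\rho df_\bot$; (2) $\mathsf{sp}$ is transitive on $\Delta_P$, and $\mathsf{sp}(p,q)$ implies $p,q\in\Delta_P$ and $P[\![p]\!]\subseteq P[\![q]\!]$; $\mathsf{sc}$ is transitive on $\Delta_C$, and $\mathsf{sc}(c,d)$ implies $c,d\in\Delta_C$ and $C[\![c]\!]\subseteq C[\![d]\!]$; (3) $x\in C[\![c]\!]$ iff $\mathsf{type}(x,c)$, and $\mathsf{type}(x,c)$ implies $c\in\Delta_C$; each of $\mathsf{dom}(p,c)$, $\mathsf{range}(p,c)$ implies $p\in\Delta_P$,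 $c\in\Delta_C$; if $(x,y)\in P[\![p]\!]$, then $\mathsf{dom}(p,c)$ implies $x\in C[\![c]\!]$ and $\mathsf{range}(p,c)$ implies $y\in C[\![c]\!]$; (4) $\bot_c$ is a symmetric relation on $\Delta_C$ such that $\bot_c(c,d)$ and $\mathsf{sc}(e,c)$ imply $\bot_c(e,d)$, and $\bot_c(c,c)$ implies $\bot_c(c,d)$ for all $d\in\Delta_C$; the same holds for $\bot_p$ with $\mathsf{sp}$ and $\Delta_P$; (5) $\mathsf{dom}(p,c)$, $\mathsf{dom}(q,d)$ and $\bot_c(c,d)$ imply $\bot_p(p,q)$; likewise with $\mathsf{range}$ for $\mathsf{dom}$. Write $\mathcal I\Vdash\tau$ for $\mathcal I\Vdash\{\tau\}$. **Minimal entailment.** Let $\mathscr M$ be the set of all interpretations over $V=\rho df_\bot\cup\mathrm{uni}(G^s)$ with the following domains: $\Delta_R=V$; $\Delta_L=\mathrm{uni}(G^s)\cap\mathbf L$; $\Delta_P$ consists of $\rho df_\bot$ and all $p\in\mathrm{uni}(G^s)$ that are the predicate of a triple in $\mathrm{Cl}(G^s)$, or the subject or object of an $\mathsf{sp}$- or $\bot_p$-triple,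 or the subject of a $\mathsf{dom}$- or $\mathsf{range}$-triple in $\mathrm{Cl}(G^s)$; $\Delta_C$ consists of all $c\in\mathrm{uni}(G^s)$ that are the subject or object of an $\mathsf{sc}$- or $\bot_c$-triple, or the object of a $\mathsf{type}$-, $\mathsf{dom}$- or $\mathsf{range}$-triple in $\mathrm{Cl}(G^s)$. A ranked interpretation is a function $r\colon\mathscr M\to\mathbb N\cup\{\infty\}$ that takes the value $0$ and, with each finite value $i>0$, also the value $i-1$. It satisfies a triple $\tau$ if $\mathcal I\Vdash\tau$ for every $\mathcal I$ of finite rank; it satisfies $\langle p,\mathsf{sp},q\rangle$ if $\mathcal I\Vdash(p,\mathsf{sp},q)$ for every $\mathcal I$ of least rank among the interpretations of finite rank with $\mathcal I\not\Vdash(p,\bot_p,p)$; and it satisfies $\langle c,\mathsf{sc},d\rangle$ if the same holds with $\mathsf{sc},\bot_c$ in place of $\mathsf{sp},\bot_p$. It is a ranked model of $G$ if it satisfies all members of $G^{str}$ and $G^{def}$. $G\models_{\min}\delta$ means that $\delta$ is satisfied by the unique ranked model of $G$ that is minimal for the pointwise order of ranks. **Procedures.** $\mathtt{Ranking}(G)$: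 put $D_0=G^{def}$ and let $D_{i+1}=\{\langle p,\mathsf{sc},q\rangle\in D_i\mid G^{str}\cup D_i^s\vdash(p,\bot_c,p)\}\cup\{\langle p,\mathsf{sp},q\rangle\in D_i\mid G^{str}\cup D_i^s\vdash(p,\bot_p,p)\}$. Stop at the first $n\ge0$ with $D_{n+1}=D_n$ and return $\mathtt r(G)=(D_0,\dots,D_n,D_\infty)$ with $D_\infty=D_{n+1}$. $\mathtt{DefMinEntailmentP}(G,\mathtt r(G),\langle p,\mathsf{sp},q\rangle)$: find the least $j\le n$ with $G^{str}\cup D_j^s\not\vdash(p,\bot_p,p)$; if there is none, return true. Otherwise (with $D_{n+1}=D_\infty$) let $D^p$ be the set of all $\langle r,\mathsf{sp},s\rangle\in D_j\setminus D_{j+1}$ and return whether $G^{str}\cup(D^p)^s\vdash(p,\mathsf{sp},q)$. **Theorem.** For every defeasible graph $G$ and every defeasible triple $\langle p,\mathsf{sp},q\rangle$, $$G\models_{\min}\langle p,\mathsf{sp},q\rangle\quad\text{iff}\quad\mathtt{DefMinEntailmentP}(G,\mathtt r(G),\langle p,\mathsf{sp},q\rangle)\text{ returns true.}$$ -/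

import Mathlib

namespace RhoDf

universe u v w

/-! ## Terms, triples, graphs -/

/-- The vocabulary `{sp, sc, type, dom, range, ⊥c, ⊥p}`. -/
inductive Voc
  | sp | sc | typ | dom | range | botc | botp

/-- Terms outside the reserved vocabulary: URI references (indexed by `U`), plain literals
(indexed by `P`) and typed literals (indexed by `T`). -/
inductive Name (U : Type u) (P : Type v) (T : Type w)
  | uri (x : U)
  | plain (l : P)
  | typed (l : T)

/-- URI references, the reserved ones included: what may stand as the predicate of a triple. -/
inductive Pred (U : Type u)
  | voc (e : Voc)
  | uri (x : U)

/-- All terms: the URI references, which contain the reserved vocabulary, and the literals. -/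
inductive Term (U : Type u) (P : Type v) (T : Type w)
  | voc (e : Voc)
  | name (a : Name U P T)

variable {U : Type u} {P : Type v} {T : Type w}

/-- A URI reference as a term. -/
def Pred.toTerm : Pred U → Term U P T
  | .voc e => .voc e
  | .uri x => .name (.uri x)

def Term.IsPlain : Term U P T → Prop
  | .name (.plain _) => True
  | _ => False

def Term.IsLiteral : Term U P T → Prop
  | .name (.plain _) => True
  | .name (.typed _) => True
  | _ => False

/-- A triple `(s, p, o)`: `p` is a URI reference, and `s`, `o` are terms outside the reserved
vocabulary. -/
structure Triple (U : Type u) (P : Type v) (T : Type w) where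
  subj : Name U P T
  pred : Pred U
  obj : Name U P T

abbrev Graph (U : Type u) (P : Type v) (T : Type w) := Set (Triple U P T)

/-- The triple `(a, e, b)` whose predicate is the reserved term `e`. -/
abbrev tri (a : Name U P T) (e : Voc) (b : Name U P T) : Triple U P T := ⟨a, .voc e, b⟩

/-- The terms that occur in the triples of `G`. -/
def uni (G : Graph U P T) : Set (Term U P T) :=
  {t | ∃ τ ∈ G, t = .name τ.subj ∨ t = τ.pred.toTerm ∨ t = .name τ.obj}

/-- The vocabulary over which the models of `G` are taken. -/
def vocab (G : Graph U P T) : Set (Term U P T) := Set.range Term.voc ∪ uni G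

/-! ## Deduction -/

/-- `Rule R τ`: the set `R` of premises and the conclusion `τ` form an instance of one of the
inference rules. The metavariables range over all terms, subject to premises and conclusion
being triples. -/
inductive Rule : Graph U P T → Triple U P T → Prop
  | sp_trans (A B C : Name U P T) : Rule {tri A .sp B, tri B .sp C} (tri A .sp C)
  | sp_inst (D E : U) (X Y : Name U P T) :
      Rule {tri (.uri D) .sp (.uri E), ⟨X, .uri D, Y⟩} ⟨X, .uri E, Y⟩
  | sc_trans (A B C : Name U P T) : Rule {tri A .sc B, tri B .sc C} (tri A .sc C)
  | sc_inst (A B X : Name U P T) : Rule {tri A .sc B, tri X .typ A} (tri X .typ B)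
  | dom (D : U) (B X Y : Name U P T) :
      Rule {tri (.uri D) .dom B, ⟨X, .uri D, Y⟩} (tri X .typ B)
  | range (D : U) (B X Y : Name U P T) :
      Rule {tri (.uri D) .range B, ⟨X, .uri D, Y⟩} (tri Y .typ B)
  | botc_symm (A B : Name U P T) : Rule {tri A .botc B} (tri B .botc A)
  | botc_sc (A B C : Name U P T) : Rule {tri A .botc B, tri C .sc A} (tri C .botc B)
  | botc_exh (A B : Name U P T) : Rule {tri A .botc A} (tri A .botc B)
  | botp_symm (A B : Name U P T) : Rule {tri A .botp B} (tri B .botp A)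
  | botp_sp (A B C : Name U P T) : Rule {tri A .botp B, tri C .sp A} (tri C .botp B)
  | botp_exh (A B : Name U P T) : Rule {tri A .botp A} (tri A .botp B)
  | cross_dom (A B C D : Name U P T) :
      Rule {tri A .dom C, tri B .dom D, tri C .botc D} (tri A .botp B)
  | cross_range (A B C D : Name U P T) :
      Rule {tri A .range C, tri B .range D, tri C .botc D} (tri A .botp B)

/-- One step of a proof: pass to a subgraph, or add the conclusion of a rule instance. -/
def Step (G H : Graph U P T) : Prop :=
  H ⊆ G ∨ ∃ R τ, Rule R τ ∧ R ⊆ G ∧ H = G ∪ {τ}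

/-- `G ⊢ H`: there is a finite sequence of graphs from `G` to `H`, each obtained from the
previous one by a proof step. -/
def Derives (G H : Graph U P T) : Prop := Relation.ReflTransGen Step G H

/-- The closure of a graph under the inference rules. -/
inductive Cl (G : Graph U P T) : Triple U P T → Prop
  | base {τ : Triple U P T} : τ ∈ G → Cl G τ
  | rule {R : Graph U P T} {τ : Triple U P T} : Rule R τ → (∀ σ ∈ R, Cl G σ) → Cl G τ

/-! ## Interpretations -/

/-- The four interpretation domains: resources, properties, classes, literal values. -/
structure Domains (U : Type u) (P : Type v) (T : Type w) where
  res : Set (Term U P T)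
  prop : Set (Term U P T)
  cls : Set (Term U P T)
  lit : Set (Term U P T)

/-- The domains of the canonical model of a graph. -/
def canonicalDomains (G : Graph U P T) : Domains U P T where
  res := uni G ∪ Set.range Term.voc
  prop := {t | t ∈ uni G ∧ ∃ τ, Cl G τ ∧ t = τ.pred.toTerm} ∪ Set.range Term.voc ∪
    {t | t ∈ uni G ∧ ∃ p q, t = .name p ∧
      (Cl G (tri p .sp q) ∨ Cl G (tri q .sp p) ∨ Cl G (tri p .dom q) ∨
        Cl G (tri p .range q) ∨ Cl G (tri p .botp q) ∨ Cl G (tri q .botp p))}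
  cls := {t | t ∈ uni G ∧ ∃ x c, t = .name c ∧ Cl G (tri x .typ c)} ∪
    {t | t ∈ uni G ∧ ∃ c d, t = .name c ∧
      (Cl G (tri c .sc d) ∨ Cl G (tri d .sc c) ∨ Cl G (tri d .dom c) ∨
        Cl G (tri d .range c) ∨ Cl G (tri c .botc d) ∨ Cl G (tri d .botc c))}
  lit := {t | t ∈ uni G ∧ t.IsLiteral}

/-- An interpretation over the vocabulary `V` with the domains `D`. -/
structure Interp (D : Domains U P T) (V : Set (Term U P T)) where
  cls_sub : D.cls ⊆ D.res
  lit_sub : D.lit ⊆ D.res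
  lit_mem : ∀ t ∈ V, t.IsLiteral → t ∈ D.lit
  /-- extensions of properties -/
  extP : D.prop → Set (D.res × D.res)
  /-- extensions of classes -/
  extC : D.cls → Set D.res
  /-- denotations of terms -/
  den : V → Term U P T
  den_mem : ∀ t, den t ∈ D.res ∪ D.prop
  den_plain : ∀ t : V, t.1.IsPlain → den t = t.1
  den_lit : ∀ t : V, t.1.IsLiteral → den t ∈ D.res

namespace Interp

variable {D : Domains U P T} {V : Set (Term U P T)}

/-- `x` is a property and `(a, b)` belongs to its extension. -/
def InProp (I : Interp D V) (x a b : Term U P T) : Prop :=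
  ∃ (hx : x ∈ D.prop) (ha : a ∈ D.res) (hb : b ∈ D.res), (⟨a, ha⟩, ⟨b, hb⟩) ∈ I.extP ⟨x, hx⟩

/-- `c` is a class and `a` belongs to its extension. -/
def InCls (I : Interp D V) (c a : Term U P T) : Prop :=
  ∃ (hc : c ∈ D.cls) (ha : a ∈ D.res), ⟨a, ha⟩ ∈ I.extC ⟨c, hc⟩

/-- `(a, b)` belongs to the extension of the denotation of the reserved term `e`. -/
def Rel (I : Interp D V) (e : Voc) (a b : Term U P T) : Prop :=
  ∃ he : Term.voc e ∈ V, I.InProp (I.den ⟨_, he⟩) a b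

/-- `I` is a model of `G`. -/
structure IsModel (I : Interp D V) (G : Graph U P T) : Prop where
  vocab_sub : vocab G ⊆ V
  simple : ∀ τ ∈ G, ∃ (hs : Term.name τ.subj ∈ V) (hp : τ.pred.toTerm ∈ V)
    (ho : Term.name τ.obj ∈ V), I.InProp (I.den ⟨_, hp⟩) (I.den ⟨_, hs⟩) (I.den ⟨_, ho⟩)
  sp_trans : ∀ p ∈ D.prop, ∀ q ∈ D.prop, ∀ r ∈ D.prop,
    I.Rel .sp p q → I.Rel .sp q r → I.Rel .sp p r
  sp_sub : ∀ p q, I.Rel .sp p q →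
    p ∈ D.prop ∧ q ∈ D.prop ∧ ∀ x y, I.InProp p x y → I.InProp q x y
  sc_trans : ∀ c ∈ D.cls, ∀ d ∈ D.cls, ∀ e ∈ D.cls,
    I.Rel .sc c d → I.Rel .sc d e → I.Rel .sc c e
  sc_sub : ∀ c d, I.Rel .sc c d →
    c ∈ D.cls ∧ d ∈ D.cls ∧ ∀ x, I.InCls c x → I.InCls d x
  typ_iff : ∀ x c, I.InCls c x ↔ I.Rel .typ x c
  typ_dom : ∀ p c x y, I.Rel .dom p c → I.InProp p x y → I.InCls c x
  typ_range : ∀ p c x y, I.Rel .range p c → I.InProp p x y → I.InCls c y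
  voc_prop : ∀ e : Voc, ∃ he : Term.voc e ∈ V, I.den ⟨_, he⟩ ∈ D.prop
  dom_mem : ∀ p c, I.Rel .dom p c → p ∈ D.prop ∧ c ∈ D.cls
  range_mem : ∀ p c, I.Rel .range p c → p ∈ D.prop ∧ c ∈ D.cls
  typ_mem : ∀ x c, I.Rel .typ x c → c ∈ D.cls
  botc_mem : ∀ c d, I.Rel .botc c d → c ∈ D.cls ∧ d ∈ D.cls
  botc_symm : ∀ c d, I.Rel .botc c d → I.Rel .botc d c
  botc_sc : ∀ c d e, I.Rel .botc c d → I.Rel .sc e c → I.Rel .botc e d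
  botc_exh : ∀ c, I.Rel .botc c c → ∀ d ∈ D.cls, I.Rel .botc c d
  botp_mem : ∀ p q, I.Rel .botp p q → p ∈ D.prop ∧ q ∈ D.prop
  botp_symm : ∀ p q, I.Rel .botp p q → I.Rel .botp q p
  botp_sp : ∀ p q r, I.Rel .botp p q → I.Rel .sp r p → I.Rel .botp r q
  botp_exh : ∀ p, I.Rel .botp p p → ∀ q ∈ D.prop, I.Rel .botp p q
  cross_dom : ∀ p q c d, I.Rel .dom p c → I.Rel .dom q d → I.Rel .botc c d → I.Rel .botp p q
  cross_range : ∀ p q c d,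
    I.Rel .range p c → I.Rel .range q d → I.Rel .botc c d → I.Rel .botp p q

/-- `I` satisfies the triple `τ`. -/
def Sat (I : Interp D V) (τ : Triple U P T) : Prop := I.IsModel {τ}

end Interp

/-! ## Defeasible graphs -/

/-- The two predicates that a defeasible triple may have. -/
inductive Kind
  | sc | sp

/-- A defeasible triple `⟨s, sc, o⟩` or `⟨s, sp, o⟩`. -/
structure DTriple (U : Type u) (P : Type v) (T : Type w) where
  subj : Name U P T
  kind : Kind
  obj : Name U P T

/-- The strict triple with the same components. -/
def DTriple.strict (δ : DTriple U P T) : Triple U P T :=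
  match δ.kind with
  | .sc => tri δ.subj .sc δ.obj
  | .sp => tri δ.subj .sp δ.obj

/-- A (finite) defeasible graph: its strict triples and its defeasible triples. -/
structure DGraph (U : Type u) (P : Type v) (T : Type w) where
  str : Finset (Triple U P T)
  dft : Finset (DTriple U P T)

/-- The graph consisting of the triples in `S` and the strict versions of those in `D`. -/
def withStrict (S : Finset (Triple U P T)) (D : Finset (DTriple U P T)) : Graph U P T :=
  {τ | τ ∈ S} ∪ {τ | ∃ δ ∈ D, τ = δ.strict}

/-- The strict counterpart of a defeasible graph. -/
def DGraph.strict (G : DGraph U P T) : Graph U P T := withStrict G.str G.dft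

/-! ## Ranked interpretations and minimal entailment -/

/-- A ranked interpretation: a convex ranking of all interpretations with given domains (over a
given vocabulary). -/
@[ext] structure RankedInterp (D : Domains U P T) (V : Set (Term U P T)) where
  rank : Interp D V → ℕ∞
  exists_zero : ∃ I, rank I = 0
  convex : ∀ (i : ℕ) (I : Interp D V), rank I = ((i + 1 : ℕ) : ℕ∞) → ∃ J, rank J = (i : ℕ∞)

namespace RankedInterp

variable {D : Domains U P T} {V : Set (Term U P T)}

/-- The interpretations of least rank among those of finite rank that do not satisfy `τ`. -/
def minFalsifying (R : RankedInterp D V) (τ : Triple U P T) : Set (Interp D V) :=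
  {I | R.rank I ≠ ⊤ ∧ ¬ I.Sat τ ∧ ¬ ∃ J, R.rank J ≠ ⊤ ∧ ¬ J.Sat τ ∧ R.rank J < R.rank I}

/-- The most expected interpretations in which `t` is nonempty as a class. -/
def cMin (R : RankedInterp D V) (t : Name U P T) : Set (Interp D V) :=
  R.minFalsifying (tri t .botc t)

/-- The most expected interpretations in which `t` is nonempty as a property. -/
def pMin (R : RankedInterp D V) (t : Name U P T) : Set (Interp D V) :=
  R.minFalsifying (tri t .botp t)

def SatStrict (R : RankedInterp D V) (τ : Triple U P T) : Prop :=
  ∀ I, R.rank I ≠ ⊤ → I.Sat τ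

def SatDef (R : RankedInterp D V) (δ : DTriple U P T) : Prop :=
  match δ.kind with
  | .sc => ∀ I ∈ R.cMin δ.subj, I.Sat (tri δ.subj .sc δ.obj)
  | .sp => ∀ I ∈ R.pMin δ.subj, I.Sat (tri δ.subj .sp δ.obj)

def IsModel (R : RankedInterp D V) (G : DGraph U P T) : Prop :=
  (∀ τ ∈ G.str, R.SatStrict τ) ∧ ∀ δ ∈ G.dft, R.SatDef δ

/-- The presumption ordering. -/
def Le (R R' : RankedInterp D V) : Prop := ∀ I, R.rank I ≤ R'.rank I

def Lt (R R' : RankedInterp D V) : Prop := R.Le R' ∧ ¬ R'.Le R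

end RankedInterp

namespace DGraph

/-- The ranked interpretations built from `G`: they rank all interpretations, over the vocabulary
of `G`, that have the domains of the canonical model of the strict counterpart of `G`. -/
abbrev Ranked (G : DGraph U P T) :=
  RankedInterp (canonicalDomains G.strict) (vocab G.strict)

def rankedModels (G : DGraph U P T) : Set G.Ranked := {R | R.IsModel G}

def minModels (G : DGraph U P T) : Set G.Ranked :=
  {R | R ∈ G.rankedModels ∧ ¬ ∃ R' ∈ G.rankedModels, R'.Lt R}

/-- `G` minimally entails `δ`: the unique minimal ranked model of `G` satisfies `δ`. -/
def MinEntails (G : DGraph U P T) (δ : DTriple U P T) : Prop :=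
  ∃ R : G.Ranked, G.minModels = {R} ∧ R.SatDef δ

end DGraph

/-! ## The procedures -/

open Classical in
/-- The exceptional triples `⟨p, sc, q⟩` of the graph with strict part `S` and defeasible
part `D`. -/
noncomputable def exceptionalC (S : Finset (Triple U P T)) (D : Finset (DTriple U P T)) :
    Finset (DTriple U P T) :=
  {δ ∈ D | δ.kind = .sc ∧ Derives (withStrict S D) {tri δ.subj .botc δ.subj}}

open Classical in
/-- The exceptional triples `⟨p, sp, q⟩` of the graph with strict part `S` and defeasible
part `D`. -/
noncomputable def exceptionalP (S : Finset (Triple U P T)) (D : Finset (DTriple U P T)) :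
    Finset (DTriple U P T) :=
  {δ ∈ D | δ.kind = .sp ∧ Derives (withStrict S D) {tri δ.subj .botp δ.subj}}

open Classical in
/-- The level that follows `D` in the ranking. -/
noncomputable def nextLevel (S : Finset (Triple U P T)) (D : Finset (DTriple U P T)) :
    Finset (DTriple U P T) :=
  exceptionalC S D ∪ exceptionalP S D

theorem nextLevel_subset (S : Finset (Triple U P T)) (D : Finset (DTriple U P T)) :
    nextLevel S D ⊆ D := by
  classical
  exact Finset.union_subset (Finset.filter_subset _ _) (Finset.filter_subset _ _)

/-- The output of the ranking procedure: the levels `D₀, …, Dₙ` and the level `D_∞`. -/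
structure Ranking (U : Type u) (P : Type v) (T : Type w) where
  levels : List (Finset (DTriple U P T))
  top : Finset (DTriple U P T)

open Classical in
/-- The loop of the ranking procedure, started at the level `D`: compute the next level; if it
equals `D`, stop with `D` as the last level and the new level as `D_∞`, else go on. -/
noncomputable def rankingLoop (S : Finset (Triple U P T)) (D : Finset (DTriple U P T)) :
    Ranking U P T :=
  if nextLevel S D = D then ⟨[D], nextLevel S D⟩
  else ⟨D :: (rankingLoop S (nextLevel S D)).levels, (rankingLoop S (nextLevel S D)).top⟩
termination_by D.card
decreasing_by
  all_goals
    exact Finset.card_lt_card (lt_of_le_of_ne (nextLevel_subset S D) (by assumption))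

/-- The ranking `r(G)` of a defeasible graph. -/
noncomputable def ranking (G : DGraph U P T) : Ranking U P T := rankingLoop G.str G.dft

open Classical in
/-- The loop of the decision procedure for `⟨p, sp, q⟩`, run through the remaining levels
`Dᵢ, …, Dₙ`; `top` is `D_∞ = Dₙ₊₁`. -/
noncomputable def defMinEntailmentLoop (S : Finset (Triple U P T)) (top : Finset (DTriple U P T))
    (p q : Name U P T) : List (Finset (DTriple U P T)) → Bool
  | [] => true
  | D :: rest =>
    if Derives (withStrict S D) {tri p .botp p} then defMinEntailmentLoop S top p q rest
    else decide (Derives (withStrict S {δ ∈ D \ rest.headD top | δ.kind = .sp}) {tri p .sp q})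

/-- The decision procedure for defeasible triples `⟨p, sp, q⟩`. -/
noncomputable def defMinEntailmentP (G : DGraph U P T) (r : Ranking U P T) (p q : Name U P T) :
    Bool :=
  defMinEntailmentLoop G.str r.top p q r.levels

end RhoDf

namespace RhoDf

universe u v w

variable {U : Type u} {P : Type v} {T : Type w}

/-! ## Derivability and closure -/

/-! Call a term empty if it is disjoint from itself. An interpretation respects a level `L` if it
satisfies the strict triples, and each member of `L` whose subject is not empty in it. Two facts
link this to derivability from the strict part together with `L`. Soundness
(`Respects.satUpToEmpty`): derived triples with predicates other than `type` and URIs outside the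
reserved vocabulary hold up to emptiness of their terms. On a triple stating emptiness the
exceptions collapse, so derived emptiness really holds. Completeness (`canonicalInterp_isModel`):
the canonical interpretation of `L` respects `L`, and its `sp`-triples and empty terms are exactly
the derivable ones. Hence emptiness is derivable at a level iff it holds in every interpretation
respecting that level (`cl_empty_iff`). Ranking each interpretation by the first level it respects
therefore gives a ranked model, and it lies below every other one (`minRanked_isModel`,
`minRanked_le`). Its least interpretations with `p` nonempty are those that respect the first level
`i` where emptiness of `p` is not derivable. By soundness and completeness all of them satisfy `(p,
sp, q)` iff this triple is derivable at level `i`. Only `sp`-transitivity concludes `sp`-triples,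
and an exceptional link would make `p` empty, so the unexceptional `sp`-triples suffice
(`cl_sp_unexceptionalP`), as the procedure assumes. -/

theorem Rule.finite {R : Graph U P T} {τ : Triple U P T} (h : Rule R τ) : R.Finite := by
  cases h <;> exact Set.toFinite _

theorem Cl.mono {G H : Graph U P T} (hGH : G ⊆ H) {τ : Triple U P T} (h : Cl G τ) : Cl H τ := by
  induction h with
  | base h => exact .base (hGH h)
  | rule hR _ ih => exact .rule hR ih

theorem Cl.rule₁ {G : Graph U P T} {σ τ : Triple U P T} (hR : Rule {σ} τ) (h : Cl G σ) :
    Cl G τ :=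
  .rule hR fun _ hρ => by rw [Set.mem_singleton_iff.1 hρ]; exact h

theorem Cl.rule₂ {G : Graph U P T} {σ₁ σ₂ τ : Triple U P T} (hR : Rule {σ₁, σ₂} τ)
    (h₁ : Cl G σ₁) (h₂ : Cl G σ₂) : Cl G τ :=
  .rule hR fun _ hρ => by rcases hρ with rfl | rfl <;> assumption

theorem Cl.rule₃ {G : Graph U P T} {σ₁ σ₂ σ₃ τ : Triple U P T} (hR : Rule {σ₁, σ₂, σ₃} τ)
    (h₁ : Cl G σ₁) (h₂ : Cl G σ₂) (h₃ : Cl G σ₃) : Cl G τ :=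
  .rule hR fun _ hρ => by rcases hρ with rfl | rfl | rfl <;> assumption

theorem Derives.cl {G H : Graph U P T} (h : Derives G H) : ∀ τ ∈ H, Cl G τ := by
  induction h with
  | refl => exact fun _ => .base
  | tail _ hs ih =>
    rcases hs with hs | ⟨R, σ, hR, hRG, rfl⟩
    · exact fun τ hτ => ih τ (hs hτ)
    · rintro τ (hτ | rfl)
      · exact ih τ hτ
      · exact .rule hR fun ρ hρ => ih ρ (hRG hρ)

/-- The hypothesis ranges over all extensions of `G`, so the members of `R` can be added one at a
time on top of those already obtained. -/
theorem derives_union_of_forall {G : Graph U P T} {R : Graph U P T} (hR : R.Finite)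
    (h : ∀ σ ∈ R, ∀ K, G ⊆ K → Derives K (K ∪ {σ})) :
    ∀ K, G ⊆ K → Derives K (K ∪ R) := by
  induction R, hR using Set.Finite.induction_on with
  | empty => intro K _; rw [Set.union_empty]; exact .refl
  | @insert σ R _ _ ih =>
    intro K hK
    have h₁ := ih (fun ρ hρ => h ρ (Set.mem_insert_of_mem _ hρ)) K hK
    have h₂ := h σ (Set.mem_insert _ _) (K ∪ R) (hK.trans Set.subset_union_left)
    have e : K ∪ insert σ R = K ∪ R ∪ {σ} := by
      rw [Set.union_assoc, Set.union_singleton]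
    rw [e]
    exact h₁.trans h₂

/-- A closure proof is a tree, whereas a derivation is a linear sequence. Working over an arbitrary
`K ⊇ G` and keeping `K` lets the subtrees be run in succession without losing earlier conclusions.
-/
theorem Cl.derives_union {G : Graph U P T} {τ : Triple U P T} (h : Cl G τ) :
    ∀ K, G ⊆ K → Derives K (K ∪ {τ}) := by
  induction h with
  | base h =>
    intro K hK
    exact .single (.inl (Set.union_subset subset_rfl (Set.singleton_subset_iff.2 (hK h))))
  | @rule R τ hR _ ih =>
    intro K hK
    refine (derives_union_of_forall hR.finite ih K hK).trans ?_
    refine .tail (.single (.inr ⟨R, τ, hR, Set.subset_union_right, rfl⟩)) (.inl ?_)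
    exact Set.union_subset_union_left _ Set.subset_union_left

theorem derives_singleton_iff {G : Graph U P T} {τ : Triple U P T} :
    Derives G {τ} ↔ Cl G τ :=
  ⟨fun h => h.cl τ rfl, fun h =>
    (h.derives_union G subset_rfl).tail (.inl Set.subset_union_right)⟩

/-! ## Satisfaction of triples with a reserved predicate -/

namespace Interp

variable {D : Domains U P T} {V : Set (Term U P T)} {I : Interp D V}

theorem IsModel.mono {G H : Graph U P T} (h : I.IsModel G) (hHG : H ⊆ G) : I.IsModel H :=
  { h with
    vocab_sub := by
      refine fun t ht => h.vocab_sub ?_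
      rcases ht with ht | ⟨τ, hτ, ht⟩
      · exact .inl ht
      · exact .inr ⟨τ, hHG hτ, ht⟩
    simple := fun τ hτ => h.simple τ (hHG hτ) }

/-- Most model conditions do not mention the graph. Separating them as `I.IsModel ∅` lets facts
about several triples be combined under the same semantic conditions. -/
theorem sat_iff {τ : Triple U P T} :
    I.Sat τ ↔ I.IsModel ∅ ∧ ∃ (hs : Term.name τ.subj ∈ V) (hp : τ.pred.toTerm ∈ V)
      (ho : Term.name τ.obj ∈ V),
      I.InProp (I.den ⟨_, hp⟩) (I.den ⟨_, hs⟩) (I.den ⟨_, ho⟩) := by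
  constructor
  · exact fun h => ⟨h.mono (Set.empty_subset _), h.simple τ rfl⟩
  · rintro ⟨h, hs, hp, ho, hτ⟩
    refine { h with vocab_sub := ?_, simple := ?_ }
    · rintro t (ht | ⟨σ, rfl, rfl | rfl | rfl⟩)
      · exact h.vocab_sub (.inl ht)
      all_goals assumption
    · rintro σ rfl
      exact ⟨hs, hp, ho, hτ⟩

theorem sat_tri_iff {a b : Name U P T} {e : Voc} :
    I.Sat (tri a e b) ↔ I.IsModel ∅ ∧ ∃ (ha : Term.name a ∈ V) (hb : Term.name b ∈ V),
      I.Rel e (I.den ⟨_, ha⟩) (I.den ⟨_, hb⟩) := by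
  rw [sat_iff]
  constructor
  · rintro ⟨h, ha, he, hb, hr⟩
    exact ⟨h, ha, hb, he, hr⟩
  · rintro ⟨h, ha, hb, he, hr⟩
    exact ⟨h, ha, he, hb, hr⟩

variable {A B C E : Name U P T}

theorem Sat.sp_trans (h₁ : I.Sat (tri A .sp B)) (h₂ : I.Sat (tri B .sp C)) :
    I.Sat (tri A .sp C) := by
  rw [sat_tri_iff] at *
  obtain ⟨h, ha, hb, r₁⟩ := h₁
  obtain ⟨-, _, hc, r₂⟩ := h₂
  exact ⟨h, ha, hc, h.sp_trans _ (h.sp_sub _ _ r₁).1 _ (h.sp_sub _ _ r₂).1 _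
    (h.sp_sub _ _ r₂).2.1 r₁ r₂⟩

theorem Sat.sc_trans (h₁ : I.Sat (tri A .sc B)) (h₂ : I.Sat (tri B .sc C)) :
    I.Sat (tri A .sc C) := by
  rw [sat_tri_iff] at *
  obtain ⟨h, ha, hb, r₁⟩ := h₁
  obtain ⟨-, _, hc, r₂⟩ := h₂
  exact ⟨h, ha, hc, h.sc_trans _ (h.sc_sub _ _ r₁).1 _ (h.sc_sub _ _ r₂).1 _
    (h.sc_sub _ _ r₂).2.1 r₁ r₂⟩

theorem Sat.botp_symm (h₁ : I.Sat (tri A .botp B)) : I.Sat (tri B .botp A) := by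
  rw [sat_tri_iff] at *
  obtain ⟨h, ha, hb, r₁⟩ := h₁
  exact ⟨h, hb, ha, h.botp_symm _ _ r₁⟩

theorem Sat.botc_symm (h₁ : I.Sat (tri A .botc B)) : I.Sat (tri B .botc A) := by
  rw [sat_tri_iff] at *
  obtain ⟨h, ha, hb, r₁⟩ := h₁
  exact ⟨h, hb, ha, h.botc_symm _ _ r₁⟩

theorem Sat.botp_sp (h₁ : I.Sat (tri A .botp B)) (h₂ : I.Sat (tri C .sp A)) :
    I.Sat (tri C .botp B) := by
  rw [sat_tri_iff] at *
  obtain ⟨h, ha, hb, r₁⟩ := h₁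
  obtain ⟨-, hc, _, r₂⟩ := h₂
  exact ⟨h, hc, hb, h.botp_sp _ _ _ r₁ r₂⟩

theorem Sat.botc_sc (h₁ : I.Sat (tri A .botc B)) (h₂ : I.Sat (tri C .sc A)) :
    I.Sat (tri C .botc B) := by
  rw [sat_tri_iff] at *
  obtain ⟨h, ha, hb, r₁⟩ := h₁
  obtain ⟨-, hc, _, r₂⟩ := h₂
  exact ⟨h, hc, hb, h.botc_sc _ _ _ r₁ r₂⟩

/-- Emptiness passes down to subproperties: replace one argument, swap, then replace the other. -/
theorem Sat.botp_self_of_sp (h₁ : I.Sat (tri A .botp A)) (h₂ : I.Sat (tri C .sp A)) :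
    I.Sat (tri C .botp C) :=
  (h₁.botp_sp h₂).botp_symm.botp_sp h₂

theorem Sat.botc_self_of_sc (h₁ : I.Sat (tri A .botc A)) (h₂ : I.Sat (tri C .sc A)) :
    I.Sat (tri C .botc C) :=
  (h₁.botc_sc h₂).botc_symm.botc_sc h₂

/-- An empty class is disjoint from every class, and domains are classes, so emptiness of either
domain is as good as disjointness. This is why no exception remains in the conclusion. -/
theorem Sat.cross_dom (h₁ : I.Sat (tri A .dom C)) (h₂ : I.Sat (tri B .dom E))
    (h₃ : I.Sat (tri C .botc E) ∨ I.Sat (tri C .botc C) ∨ I.Sat (tri E .botc E)) :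
    I.Sat (tri A .botp B) := by
  simp only [sat_tri_iff] at *
  obtain ⟨h, ha, hc, r₁⟩ := h₁
  obtain ⟨-, hb, he, r₂⟩ := h₂
  refine ⟨h, ha, hb, h.cross_dom _ _ _ _ r₁ r₂ ?_⟩
  rcases h₃ with ⟨-, _, _, r⟩ | ⟨-, _, _, r⟩ | ⟨-, _, _, r⟩
  · exact r
  · exact h.botc_exh _ r _ (h.dom_mem _ _ r₂).2
  · exact h.botc_symm _ _ (h.botc_exh _ r _ (h.dom_mem _ _ r₁).2)

theorem Sat.cross_range (h₁ : I.Sat (tri A .range C)) (h₂ : I.Sat (tri B .range E))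
    (h₃ : I.Sat (tri C .botc E) ∨ I.Sat (tri C .botc C) ∨ I.Sat (tri E .botc E)) :
    I.Sat (tri A .botp B) := by
  simp only [sat_tri_iff] at *
  obtain ⟨h, ha, hc, r₁⟩ := h₁
  obtain ⟨-, hb, he, r₂⟩ := h₂
  refine ⟨h, ha, hb, h.cross_range _ _ _ _ r₁ r₂ ?_⟩
  rcases h₃ with ⟨-, _, _, r⟩ | ⟨-, _, _, r⟩ | ⟨-, _, _, r⟩
  · exact r
  · exact h.botc_exh _ r _ (h.range_mem _ _ r₂).2
  · exact h.botc_symm _ _ (h.botc_exh _ r _ (h.range_mem _ _ r₁).2)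

end Interp

/-! ## Soundness up to emptiness of subjects -/

/-- The triple stating that the subject of `δ` is empty. -/
def DTriple.empty (δ : DTriple U P T) : Triple U P T :=
  match δ.kind with
  | .sc => tri δ.subj .botc δ.subj
  | .sp => tri δ.subj .botp δ.subj

namespace Interp

variable {D : Domains U P T} {V : Set (Term U P T)}

/-- `I` satisfies all triples in `S`, and satisfies each member of `L` unless its subject is
empty. -/
def Respects (I : Interp D V) (S : Finset (Triple U P T)) (L : Finset (DTriple U P T)) : Prop :=
  (∀ τ ∈ S, I.Sat τ) ∧ ∀ δ ∈ L, I.Sat δ.empty ∨ I.Sat δ.strict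

/-- `I` satisfies the triple `τ`, up to emptiness of its subject or object; a vacuous condition for
predicates that do not contribute to the derivation of disjointness. -/
def SatUpToEmpty (I : Interp D V) (τ : Triple U P T) : Prop :=
  match τ.pred with
  | .voc .sp => I.Sat (tri τ.subj .sp τ.obj) ∨ I.Sat (tri τ.subj .botp τ.subj)
  | .voc .sc => I.Sat (tri τ.subj .sc τ.obj) ∨ I.Sat (tri τ.subj .botc τ.subj)
  | .voc .botp => I.Sat (tri τ.subj .botp τ.obj) ∨ I.Sat (tri τ.subj .botp τ.subj) ∨
      I.Sat (tri τ.obj .botp τ.obj)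
  | .voc .botc => I.Sat (tri τ.subj .botc τ.obj) ∨ I.Sat (tri τ.subj .botc τ.subj) ∨
      I.Sat (tri τ.obj .botc τ.obj)
  | .voc .dom => I.Sat (tri τ.subj .dom τ.obj)
  | .voc .range => I.Sat (tri τ.subj .range τ.obj)
  | .voc .typ => True
  | .uri _ => True

variable {I : Interp D V} {S : Finset (Triple U P T)} {L : Finset (DTriple U P T)}

theorem Sat.satUpToEmpty {τ : Triple U P T} (h : I.Sat τ) : I.SatUpToEmpty τ := by
  obtain ⟨s, ⟨e⟩ | x, o⟩ := τ
  · cases e <;> simp [SatUpToEmpty, h]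
  · trivial

/-- Emptiness travels from a superterm to its subterms, so an exception in a premise becomes one
allowed in the conclusion. `dom`- and `range`-triples need no exception because no rule concludes
them. `type`-triples and those with a URI predicate outside the reserved vocabulary need not be
tracked: rules using them only conclude triples of these two sorts. -/
theorem Rule.satUpToEmpty {R : Graph U P T} {τ : Triple U P T} (hR : Rule R τ)
    (h : ∀ σ ∈ R, I.SatUpToEmpty σ) : I.SatUpToEmpty τ := by
  cases hR <;>
    simp only [Set.mem_insert_iff, Set.mem_singleton_iff, forall_eq_or_imp, forall_eq,
      SatUpToEmpty, or_self] at h ⊢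
  case sp_trans =>
    obtain ⟨h₁ | h₁, h₂ | h₂⟩ := h
    · exact .inl (h₁.sp_trans h₂)
    · exact .inr (h₂.botp_self_of_sp h₁)
    all_goals exact .inr h₁
  case sc_trans =>
    obtain ⟨h₁ | h₁, h₂ | h₂⟩ := h
    · exact .inl (h₁.sc_trans h₂)
    · exact .inr (h₂.botc_self_of_sc h₁)
    all_goals exact .inr h₁
  case botc_symm =>
    obtain h | h | h := h
    · exact .inl h.botc_symm
    · exact .inr (.inr h)
    · exact .inr (.inl h)
  case botp_symm =>
    obtain h | h | h := h
    · exact .inl h.botp_symm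
    · exact .inr (.inr h)
    · exact .inr (.inl h)
  case botc_sc =>
    obtain ⟨h₁ | h₁ | h₁, h₂ | h₂⟩ := h
    · exact .inl (h₁.botc_sc h₂)
    · exact .inr (.inl h₂)
    · exact .inr (.inl (h₁.botc_self_of_sc h₂))
    · exact .inr (.inl h₂)
    all_goals exact .inr (.inr h₁)
  case botp_sp =>
    obtain ⟨h₁ | h₁ | h₁, h₂ | h₂⟩ := h
    · exact .inl (h₁.botp_sp h₂)
    · exact .inr (.inl h₂)
    · exact .inr (.inl (h₁.botp_self_of_sp h₂))
    · exact .inr (.inl h₂)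
    all_goals exact .inr (.inr h₁)
  case botc_exh => exact .inr (.inl h)
  case botp_exh => exact .inr (.inl h)
  case cross_dom => exact .inl (h.1.cross_dom h.2.1 h.2.2)
  case cross_range => exact .inl (h.1.cross_range h.2.1 h.2.2)

theorem Respects.satUpToEmpty (hI : I.Respects S L) {τ : Triple U P T}
    (h : Cl (withStrict S L) τ) : I.SatUpToEmpty τ := by
  induction h with
  | base h =>
    obtain h | ⟨⟨s, k, o⟩, hδ, rfl⟩ := h
    · exact (hI.1 _ h).satUpToEmpty
    · cases k <;> exact (hI.2 _ hδ).symm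
  | rule hR _ ih => exact Rule.satUpToEmpty hR ih

/-- With equal subject and object the three alternatives for a disjointness triple coincide, so the
exceptions disappear. -/
theorem Respects.sat_empty (hI : I.Respects S L) {δ : DTriple U P T}
    (h : Cl (withStrict S L) δ.empty) : I.Sat δ.empty := by
  obtain ⟨s, k, o⟩ := δ
  have := hI.satUpToEmpty h
  cases k <;> simpa only [DTriple.empty, SatUpToEmpty, or_self] using this

theorem Respects.sat_sp (hI : I.Respects S L) {p q : Name U P T}
    (h : Cl (withStrict S L) (tri p .sp q)) :
    I.Sat (tri p .sp q) ∨ I.Sat (tri p .botp p) :=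
  hI.satUpToEmpty h

end Interp

/-! ## The canonical model of a subgraph -/

/-- `a` and `b` are names that satisfy `(a, e, b)` in the closure of `H`. -/
def ClRel (H : Graph U P T) (e : Voc) (a b : Term U P T) : Prop :=
  ∃ x y, a = .name x ∧ b = .name y ∧ Cl H (tri x e y)

/-- The disjointness relation of the canonical model: derivable disjointness, with empty terms
disjoint from everything. -/
def BotRel (H : Graph U P T) (e : Voc) (a b : Term U P T) : Prop :=
  ClRel H e a b ∨ ClRel H e a a ∨ ClRel H e b b

/-- The extensions of the reserved properties in the canonical model of `H`. -/
def vocExt (D : Domains U P T) (H : Graph U P T) : Voc → Term U P T → Term U P T → Prop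
  | .sp, a, b => a ∈ D.prop ∧ b ∈ D.prop ∧ ClRel H .sp a b
  | .sc, a, b => a ∈ D.cls ∧ b ∈ D.cls ∧ ClRel H .sc a b
  | .typ, _, b => b ∈ D.cls
  | .dom, a, b => a ∈ D.prop ∧ b ∈ D.cls ∧ ClRel H .dom a b
  | .range, a, b => a ∈ D.prop ∧ b ∈ D.cls ∧ ClRel H .range a b
  | .botc, a, b => a ∈ D.cls ∧ b ∈ D.cls ∧ BotRel H .botc a b
  | .botp, a, b => a ∈ D.prop ∧ b ∈ D.prop ∧ BotRel H .botp a b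

/-- The extensions of the properties in the canonical model of `H`. -/
def termExt (D : Domains U P T) (H : Graph U P T) : Term U P T → Term U P T → Term U P T → Prop
  | .voc e, a, b => vocExt D H e a b
  | .name _, _, _ => True

theorem mem_vocab_iff {G : Graph U P T} {t : Term U P T} :
    t ∈ vocab G ↔ t ∈ (canonicalDomains G).res := by
  exact or_comm

theorem prop_subset_res (G : Graph U P T) :
    (canonicalDomains G).prop ⊆ (canonicalDomains G).res := by
  rintro t ((h | h) | h)
  · exact .inl h.1
  · exact .inr h
  · exact .inl h.1

theorem cls_subset_res (G : Graph U P T) :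
    (canonicalDomains G).cls ⊆ (canonicalDomains G).res := by
  rintro t (h | h) <;> exact .inl h.1

/-- An interpretation over the domains given by `G` that reads the reserved vocabulary, `type`
excepted, off the closure of `H`; all other properties and all classes are as large as possible. -/
def canonicalInterp (G H : Graph U P T) : Interp (canonicalDomains G) (vocab G) where
  cls_sub := cls_subset_res G
  lit_sub := fun _ h => .inl h.1
  lit_mem := by
    rintro t (⟨e, rfl⟩ | h) hl
    · exact hl.elim
    · exact ⟨h, hl⟩
  extP := fun x => {ab | termExt (canonicalDomains G) H x.1 ab.1.1 ab.2.1}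
  extC := fun _ => Set.univ
  den := Subtype.val
  den_mem := fun t => .inl (mem_vocab_iff.1 t.2)
  den_plain := fun _ _ => rfl
  den_lit := fun t _ => mem_vocab_iff.1 t.2

section Canonical

variable {G H : Graph U P T}

theorem canonicalInterp_inProp {x a b : Term U P T} :
    (canonicalInterp G H).InProp x a b ↔ x ∈ (canonicalDomains G).prop ∧
      a ∈ (canonicalDomains G).res ∧ b ∈ (canonicalDomains G).res ∧
      termExt (canonicalDomains G) H x a b := by
  constructor
  · rintro ⟨hx, ha, hb, h⟩; exact ⟨hx, ha, hb, h⟩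
  · rintro ⟨hx, ha, hb, h⟩; exact ⟨hx, ha, hb, h⟩

theorem canonicalInterp_inCls {c a : Term U P T} :
    (canonicalInterp G H).InCls c a ↔ c ∈ (canonicalDomains G).cls ∧
      a ∈ (canonicalDomains G).res := by
  constructor
  · rintro ⟨hc, ha, -⟩; exact ⟨hc, ha⟩
  · rintro ⟨hc, ha⟩; exact ⟨hc, ha, trivial⟩

theorem voc_mem_prop (e : Voc) : Term.voc e ∈ (canonicalDomains G).prop :=
  .inl (.inr ⟨e, rfl⟩)

theorem canonicalInterp_rel {e : Voc} {a b : Term U P T} :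
    (canonicalInterp G H).Rel e a b ↔ a ∈ (canonicalDomains G).res ∧
      b ∈ (canonicalDomains G).res ∧ vocExt (canonicalDomains G) H e a b := by
  constructor
  · rintro ⟨he, h⟩; exact (canonicalInterp_inProp.1 h).2
  · intro h; exact ⟨.inl ⟨e, rfl⟩, canonicalInterp_inProp.2 ⟨voc_mem_prop e, h⟩⟩

theorem BotRel.symm {e : Voc} {a b : Term U P T} (h : BotRel H e a b)
    (hs : ∀ A B : Name U P T, Rule {tri A e B} (tri B e A)) : BotRel H e b a := by
  obtain ⟨x, y, rfl, rfl, h⟩ | h | h := h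
  · exact .inl ⟨y, x, rfl, rfl, .rule₁ (hs _ _) h⟩
  · exact .inr (.inr h)
  · exact .inr (.inl h)

/-- If `a` is derivably empty, then so is `c` below it, by two uses of the inheritance rule around a
swap. The rules are parameters so that classes and properties share the argument. -/
theorem BotRel.sub {e e' : Voc} {a b c : Term U P T} (h : BotRel H e a b) (hc : ClRel H e' c a)
    (hs : ∀ A B : Name U P T, Rule {tri A e B} (tri B e A))
    (hr : ∀ A B C : Name U P T, Rule {tri A e B, tri C e' A} (tri C e B)) :
    BotRel H e c b := by
  obtain ⟨z, x, rfl, rfl, hc⟩ := hc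
  obtain ⟨x', y, hx, rfl, h⟩ | ⟨x', y, hx, hy, h⟩ | h := h
  · cases hx
    exact .inl ⟨z, y, rfl, rfl, .rule₂ (hr _ _ _) h hc⟩
  · cases hx; cases hy
    exact .inr (.inl ⟨z, z, rfl, rfl,
      .rule₂ (hr _ _ _) (.rule₁ (hs _ _) (.rule₂ (hr _ _ _) h hc)) hc⟩)
  · exact .inr (.inr h)

theorem botRel_self {e : Voc} {a : Term U P T} : BotRel H e a a ↔ ClRel H e a a := by
  simp [BotRel]

theorem clRel_name {e : Voc} {a b : Name U P T} :
    ClRel H e (.name a) (.name b) ↔ Cl H (tri a e b) := by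
  constructor
  · rintro ⟨x, y, hx, hy, h⟩
    cases hx; cases hy
    exact h
  · exact fun h => ⟨a, b, rfl, rfl, h⟩

theorem ClRel.trans {e : Voc} {a b c : Term U P T} (h₁ : ClRel H e a b) (h₂ : ClRel H e b c)
    (hr : ∀ A B C : Name U P T, Rule {tri A e B, tri B e C} (tri A e C)) : ClRel H e a c := by
  obtain ⟨x, y, rfl, rfl, h₁⟩ := h₁
  obtain ⟨y', z, hy, rfl, h₂⟩ := h₂
  cases hy
  exact ⟨x, z, rfl, rfl, .rule₂ (hr _ _ _) h₁ h₂⟩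

theorem BotRel.cross {e : Voc} {p q c d : Term U P T} (h₁ : ClRel H e p c) (h₂ : ClRel H e q d)
    (h₃ : BotRel H .botc c d)
    (hr : ∀ A B C E : Name U P T, Rule {tri A e C, tri B e E, tri C .botc E} (tri A .botp B)) :
    BotRel H .botp p q := by
  obtain ⟨p, c, rfl, rfl, h₁⟩ := h₁
  obtain ⟨q, d, rfl, rfl, h₂⟩ := h₂
  refine .inl (clRel_name.2 (.rule₃ (hr _ _ _ _) h₁ h₂ ?_))
  simp only [BotRel, clRel_name] at h₃
  obtain h | h | h := h₃
  · exact h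
  · exact .rule₁ (.botc_exh _ _) h
  · exact .rule₁ (.botc_symm _ _) (.rule₁ (.botc_exh _ _) h)

theorem termExt_of_mem (hHG : H ⊆ G) {τ : Triple U P T} (hτ : τ ∈ H) :
    termExt (canonicalDomains G) H τ.pred.toTerm (.name τ.subj) (.name τ.obj) := by
  obtain ⟨s, e | x, o⟩ := τ
  · have hs : Term.name s ∈ uni G := ⟨_, hHG hτ, .inl rfl⟩
    have ho : Term.name o ∈ uni G := ⟨_, hHG hτ, .inr (.inr rfl)⟩
    have hG : Cl G (tri s e o) := .base (hHG hτ)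
    have hH : ClRel H e (.name s) (.name o) := clRel_name.2 (.base hτ)
    cases e
    case sp => exact ⟨.inr ⟨hs, s, o, rfl, by tauto⟩, .inr ⟨ho, o, s, rfl, by tauto⟩, hH⟩
    case sc => exact ⟨.inr ⟨hs, s, o, rfl, by tauto⟩, .inr ⟨ho, o, s, rfl, by tauto⟩, hH⟩
    case typ => exact .inl ⟨ho, s, o, rfl, hG⟩
    case dom => exact ⟨.inr ⟨hs, s, o, rfl, by tauto⟩, .inr ⟨ho, o, s, rfl, by tauto⟩, hH⟩
    case range => exact ⟨.inr ⟨hs, s, o, rfl, by tauto⟩, .inr ⟨ho, o, s, rfl, by tauto⟩, hH⟩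
    case botc =>
      exact ⟨.inr ⟨hs, s, o, rfl, by tauto⟩, .inr ⟨ho, o, s, rfl, by tauto⟩, .inl hH⟩
    case botp =>
      exact ⟨.inr ⟨hs, s, o, rfl, by tauto⟩, .inr ⟨ho, o, s, rfl, by tauto⟩, .inl hH⟩
  · trivial

/-- Full class extensions and full extensions of names make the inclusion and typing conditions
trivial; the remaining ones mirror the rules. Exhaustiveness is why `BotRel` has its emptiness
clauses: the property domain contains reserved terms, which no derivable triple can have as subject
or object. -/
theorem canonicalInterp_isModel (hHG : H ⊆ G) : (canonicalInterp G H).IsModel H where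
  vocab_sub := by
    rintro t (h | ⟨τ, hτ, h⟩)
    · exact .inl h
    · exact .inr ⟨τ, hHG hτ, h⟩
  simple := by
    intro τ hτ
    have hs : Term.name τ.subj ∈ uni G := ⟨_, hHG hτ, .inl rfl⟩
    have hp : τ.pred.toTerm ∈ uni G := ⟨_, hHG hτ, .inr (.inl rfl)⟩
    have ho : Term.name τ.obj ∈ uni G := ⟨_, hHG hτ, .inr (.inr rfl)⟩
    exact ⟨.inr hs, .inr hp, .inr ho, canonicalInterp_inProp.2
      ⟨.inl (.inl ⟨hp, τ, .base (hHG hτ), rfl⟩), .inl hs, .inl ho, termExt_of_mem hHG hτ⟩⟩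
  sp_trans := by
    simp only [canonicalInterp_rel]
    rintro p - q - r - ⟨hp, -, h₁⟩ ⟨-, hr, h₂⟩
    exact ⟨hp, hr, h₁.1, h₂.2.1, h₁.2.2.trans h₂.2.2 .sp_trans⟩
  sp_sub := by
    simp only [canonicalInterp_rel]
    rintro p q ⟨-, -, hp, hq, h⟩
    refine ⟨hp, hq, fun x y hxy => ?_⟩
    rw [canonicalInterp_inProp] at hxy ⊢
    -- The superproperty is a name, never a reserved term, so its extension is everything.
    obtain ⟨_, q, -, rfl, -⟩ := h
    exact ⟨hq, hxy.2.1, hxy.2.2.1, trivial⟩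
  sc_trans := by
    simp only [canonicalInterp_rel]
    rintro p - q - r - ⟨hp, -, h₁⟩ ⟨-, hr, h₂⟩
    exact ⟨hp, hr, h₁.1, h₂.2.1, h₁.2.2.trans h₂.2.2 .sc_trans⟩
  sc_sub := by
    simp only [canonicalInterp_rel, canonicalInterp_inCls]
    rintro c d ⟨-, -, hc, hd, -⟩
    exact ⟨hc, hd, fun x hx => ⟨hd, hx.2⟩⟩
  typ_iff := by
    simp only [canonicalInterp_rel, canonicalInterp_inCls]
    exact fun x c => ⟨fun h => ⟨h.2, cls_subset_res G h.1, h.1⟩, fun h => ⟨h.2.2, h.1⟩⟩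
  typ_dom := by
    simp only [canonicalInterp_rel, canonicalInterp_inCls, canonicalInterp_inProp]
    rintro p c x y h h'
    exact ⟨h.2.2.2.1, h'.2.1⟩
  typ_range := by
    simp only [canonicalInterp_rel, canonicalInterp_inCls, canonicalInterp_inProp]
    rintro p c x y h h'
    exact ⟨h.2.2.2.1, h'.2.2.1⟩
  voc_prop := fun e => ⟨.inl ⟨e, rfl⟩, voc_mem_prop e⟩
  dom_mem := by
    simp only [canonicalInterp_rel]
    exact fun p c h => ⟨h.2.2.1, h.2.2.2.1⟩
  range_mem := by
    simp only [canonicalInterp_rel]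
    exact fun p c h => ⟨h.2.2.1, h.2.2.2.1⟩
  typ_mem := by
    simp only [canonicalInterp_rel]
    exact fun p c h => h.2.2
  botc_mem := by
    simp only [canonicalInterp_rel]
    exact fun p c h => ⟨h.2.2.1, h.2.2.2.1⟩
  botc_symm := by
    simp only [canonicalInterp_rel]
    exact fun c d h => ⟨h.2.1, h.1, h.2.2.2.1, h.2.2.1, h.2.2.2.2.symm .botc_symm⟩
  botc_sc := by
    simp only [canonicalInterp_rel]
    exact fun c d e h h' => ⟨h'.1, h.2.1, h'.2.2.1, h.2.2.2.1,
      h.2.2.2.2.sub h'.2.2.2.2 .botc_symm .botc_sc⟩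
  botc_exh := by
    simp only [canonicalInterp_rel]
    exact fun c h d hd => ⟨h.1, cls_subset_res G hd, h.2.2.1, hd,
      .inr (.inl (botRel_self.1 h.2.2.2.2))⟩
  botp_mem := by
    simp only [canonicalInterp_rel]
    exact fun p c h => ⟨h.2.2.1, h.2.2.2.1⟩
  botp_symm := by
    simp only [canonicalInterp_rel]
    exact fun c d h => ⟨h.2.1, h.1, h.2.2.2.1, h.2.2.1, h.2.2.2.2.symm .botp_symm⟩
  botp_sp := by
    simp only [canonicalInterp_rel]
    exact fun c d e h h' => ⟨h'.1, h.2.1, h'.2.2.1, h.2.2.2.1,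
      h.2.2.2.2.sub h'.2.2.2.2 .botp_symm .botp_sp⟩
  botp_exh := by
    simp only [canonicalInterp_rel]
    exact fun c h d hd => ⟨h.1, prop_subset_res G hd, h.2.2.1, hd,
      .inr (.inl (botRel_self.1 h.2.2.2.2))⟩
  cross_dom := by
    simp only [canonicalInterp_rel]
    exact fun p q c d h₁ h₂ h₃ => ⟨h₁.1, h₂.1, h₁.2.2.1, h₂.2.2.1,
      .cross h₁.2.2.2.2 h₂.2.2.2.2 h₃.2.2.2.2 .cross_dom⟩
  cross_range := by
    simp only [canonicalInterp_rel]
    exact fun p q c d h₁ h₂ h₃ => ⟨h₁.1, h₂.1, h₁.2.2.1, h₂.2.2.1,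
      .cross h₁.2.2.2.2 h₂.2.2.2.2 h₃.2.2.2.2 .cross_range⟩

theorem canonicalInterp_vocExt_of_sat {a b : Name U P T} {e : Voc}
    (h : (canonicalInterp G H).Sat (tri a e b)) :
    vocExt (canonicalDomains G) H e (.name a) (.name b) := by
  obtain ⟨-, _, _, h⟩ := Interp.sat_tri_iff.1 h
  exact (canonicalInterp_rel.1 h).2.2

theorem cl_sp_of_canonicalInterp_sat {a b : Name U P T}
    (h : (canonicalInterp G H).Sat (tri a .sp b)) : Cl H (tri a .sp b) :=
  clRel_name.1 (canonicalInterp_vocExt_of_sat h).2.2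

theorem cl_empty_of_canonicalInterp_sat {δ : DTriple U P T}
    (h : (canonicalInterp G H).Sat δ.empty) : Cl H δ.empty := by
  obtain ⟨s, k, o⟩ := δ
  cases k <;> exact clRel_name.1 (botRel_self.1 (canonicalInterp_vocExt_of_sat h).2.2)

end Canonical

theorem withStrict_mono {S : Finset (Triple U P T)} {L L' : Finset (DTriple U P T)}
    (h : L ⊆ L') : withStrict S L ⊆ withStrict S L' := by
  rintro τ (hτ | ⟨δ, hδ, rfl⟩)
  · exact .inl hτ
  · exact .inr ⟨δ, h hδ, rfl⟩

theorem canonicalInterp_respects {G : Graph U P T} {S : Finset (Triple U P T)}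
    {L : Finset (DTriple U P T)} (h : withStrict S L ⊆ G) :
    (canonicalInterp G (withStrict S L)).Respects S L :=
  ⟨fun _ hτ => (canonicalInterp_isModel h).mono (Set.singleton_subset_iff.2 (.inl hτ)),
    fun δ hδ => .inr ((canonicalInterp_isModel h).mono
      (Set.singleton_subset_iff.2 (.inr ⟨δ, hδ, rfl⟩)))⟩

/-! ## The levels of the ranking -/

theorem mem_nextLevel {S : Finset (Triple U P T)} {L : Finset (DTriple U P T)}
    {δ : DTriple U P T} :
    δ ∈ nextLevel S L ↔ δ ∈ L ∧ Cl (withStrict S L) δ.empty := by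
  obtain ⟨s, k, o⟩ := δ
  cases k <;> simp [nextLevel, exceptionalC, exceptionalP, derives_singleton_iff, DTriple.empty]

/-- The level number `i` of the ranking that starts with `L`. -/
noncomputable def level (S : Finset (Triple U P T)) (L : Finset (DTriple U P T)) (i : ℕ) :
    Finset (DTriple U P T) :=
  (nextLevel S)^[i] L

section Level

variable {S : Finset (Triple U P T)} {L : Finset (DTriple U P T)}

theorem level_succ (i : ℕ) : level S L (i + 1) = nextLevel S (level S L i) :=
  Function.iterate_succ_apply' _ _ _

theorem level_succ' (i : ℕ) : level S L (i + 1) = level S (nextLevel S L) i :=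
  Function.iterate_succ_apply _ _ _

theorem level_antitone : Antitone (level S L) :=
  antitone_nat_of_succ_le fun i => by rw [level_succ]; exact nextLevel_subset _ _

theorem level_of_fixed (h : nextLevel S L = L) (i : ℕ) : level S L i = L :=
  Function.iterate_fixed h i

theorem Interp.Respects.mono {D : Domains U P T} {V : Set (Term U P T)} {I : Interp D V}
    {L' : Finset (DTriple U P T)} (h : I.Respects S L) (hL : L' ⊆ L) : I.Respects S L' :=
  ⟨h.1, fun δ hδ => h.2 δ (hL hδ)⟩

end Level

namespace DGraph

variable {G : DGraph U P T}

/-- The interpretations that are ranked by the models of `G`. -/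
abbrev Interps (G : DGraph U P T) := Interp (canonicalDomains G.strict) (vocab G.strict)

/-- `I` respects the level number `i`. -/
def RespectsLevel (G : DGraph U P T) (I : G.Interps) (i : ℕ) : Prop :=
  I.Respects G.str (level G.str G.dft i)

/-- The canonical model of the level number `i`. -/
def levelInterp (G : DGraph U P T) (i : ℕ) : G.Interps :=
  canonicalInterp G.strict (withStrict G.str (level G.str G.dft i))

theorem RespectsLevel.mono {I : G.Interps} {i j : ℕ} (h : G.RespectsLevel I i) (hij : i ≤ j) :
    G.RespectsLevel I j :=
  Interp.Respects.mono h (level_antitone hij)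

theorem levelInterp_respectsLevel (i : ℕ) : G.RespectsLevel (G.levelInterp i) i :=
  canonicalInterp_respects (withStrict_mono (level_antitone (Nat.zero_le i)))

/-- A triple is exceptional at a level iff its subject is empty in all interpretations that respect
the level. -/
theorem cl_empty_iff {i : ℕ} {δ : DTriple U P T} :
    Cl (withStrict G.str (level G.str G.dft i)) δ.empty ↔
      ∀ I, G.RespectsLevel I i → I.Sat δ.empty :=
  ⟨fun h _ hI => Interp.Respects.sat_empty hI h,
    fun h => cl_empty_of_canonicalInterp_sat (h _ (levelInterp_respectsLevel i))⟩

/-! ## The least ranked model -/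

open Classical in
/-- The number of the first level that an interpretation respects. -/
noncomputable def minRank (G : DGraph U P T) (I : G.Interps) : ℕ∞ :=
  if h : ∃ i, G.RespectsLevel I i then (Nat.find h : ℕ∞) else ⊤

theorem minRank_le_iff {I : G.Interps} {i : ℕ} :
    G.minRank I ≤ i ↔ G.RespectsLevel I i := by
  classical
  unfold minRank
  split_ifs with h
  · rw [Nat.cast_le, Nat.find_le_iff]
    exact ⟨fun ⟨_, hm, h⟩ => h.mono hm, fun h => ⟨i, le_rfl, h⟩⟩
  · simpa using fun h' => h ⟨i, h'⟩

theorem minRank_eq_succ_iff {I : G.Interps} {i : ℕ} :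
    G.minRank I = ((i + 1 : ℕ) : ℕ∞) ↔ G.RespectsLevel I (i + 1) ∧ ¬ G.RespectsLevel I i := by
  rw [← minRank_le_iff, ← minRank_le_iff]
  generalize G.minRank I = x
  cases x with
  | top =>
    exact ⟨fun h => absurd h.symm (ENat.natCast_ne_top _),
      fun h => absurd (top_le_iff.1 h.1) (ENat.natCast_ne_top _)⟩
  | coe n => norm_cast; omega

theorem minRank_eq_zero_iff {I : G.Interps} : G.minRank I = 0 ↔ G.RespectsLevel I 0 := by
  rw [← minRank_le_iff]; simp

/-- The ranking of interpretations by the levels that they respect. -/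
noncomputable def minRanked (G : DGraph U P T) : G.Ranked where
  rank := G.minRank
  exists_zero := ⟨G.levelInterp 0, minRank_eq_zero_iff.2 (levelInterp_respectsLevel 0)⟩
  convex := by
    intro i I hI
    obtain ⟨h₁, h₂⟩ := minRank_eq_succ_iff.1 hI
    refine ⟨G.levelInterp i, ?_⟩
    cases i with
    | zero => exact minRank_eq_zero_iff.2 (levelInterp_respectsLevel 0)
    | succ k =>
      -- If the canonical interpretation of level `k + 1` also respected level `k`, all subjects of
      -- level `k + 1` would be empty in it, hence derivably empty at that level. The levels would
      -- be stationary from there on, and `I` would already respect level `k + 1`.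
      refine minRank_eq_succ_iff.2 ⟨levelInterp_respectsLevel _, fun hk => h₂ ?_⟩
      have e : level G.str G.dft (k + 1 + 1) = level G.str G.dft (k + 1) := by
        refine (level_antitone (Nat.le_succ _)).antisymm fun δ hδ => ?_
        rw [level_succ, mem_nextLevel]
        refine ⟨hδ, cl_empty_of_canonicalInterp_sat (cl_empty_iff.1 ?_ _ hk)⟩
        rw [level_succ, mem_nextLevel] at hδ
        exact hδ.2
      unfold RespectsLevel at h₁ ⊢
      rwa [e] at h₁

end DGraph

namespace RankedInterp

variable {D : Domains U P T} {V : Set (Term U P T)}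

theorem satDef_iff {R : RankedInterp D V} {δ : DTriple U P T} :
    R.SatDef δ ↔ ∀ I ∈ R.minFalsifying δ.empty, I.Sat δ.strict := by
  obtain ⟨s, k, o⟩ := δ
  cases k <;> rfl

theorem Le.antisymm {R R' : RankedInterp D V} (h : R.Le R') (h' : R'.Le R) : R = R' :=
  RankedInterp.ext (funext fun I => le_antisymm (h I) (h' I))

end RankedInterp

namespace DGraph

variable {G : DGraph U P T}

theorem exists_respectsLevel {I : G.Interps} (h : G.minRanked.rank I ≠ ⊤) :
    ∃ i : ℕ, G.minRanked.rank I = i ∧ G.RespectsLevel I i := by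
  obtain ⟨i, hi⟩ := ENat.ne_top_iff_exists.1 h
  exact ⟨i, hi.symm, minRank_le_iff.1 hi.symm.le⟩

theorem rank_ne_top {I : G.Interps} {i : ℕ} (h : G.RespectsLevel I i) :
    G.minRanked.rank I ≠ ⊤ :=
  ne_top_of_le_ne_top (ENat.natCast_ne_top i) (minRank_le_iff.2 h)

/-- The interpretations of least rank that falsify the emptiness of a term are those that do so
and respect the first level at which the emptiness is not derivable. -/
theorem mem_minFalsifying_iff {I : G.Interps} {δ : DTriple U P T} :
    I ∈ G.minRanked.minFalsifying δ.empty ↔ ∃ i,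
      (∀ k < i, Cl (withStrict G.str (level G.str G.dft k)) δ.empty) ∧
        G.RespectsLevel I i ∧ ¬ I.Sat δ.empty := by
  constructor
  · rintro ⟨hI, hδ, hmin⟩
    obtain ⟨i, hi, hIi⟩ := exists_respectsLevel hI
    refine ⟨i, fun k hk => cl_empty_iff.2 fun J hJ => ?_, hIi, hδ⟩
    by_contra hJδ
    refine hmin ⟨J, rank_ne_top hJ, hJδ, ?_⟩
    rw [hi]
    exact (minRank_le_iff.2 hJ).trans_lt (Nat.cast_lt.2 hk)
  · rintro ⟨i, hi, hIi, hδ⟩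
    refine ⟨rank_ne_top hIi, hδ, ?_⟩
    rintro ⟨J, hJ, hJδ, hlt⟩
    obtain ⟨k, hk, hJk⟩ := exists_respectsLevel hJ
    have hki : k < i := by
      rw [hk] at hlt
      exact Nat.cast_lt.1 (hlt.trans_le (minRank_le_iff.2 hIi))
    exact hJδ (cl_empty_iff.1 (hi k hki) J hJk)

theorem minRanked_isModel : G.minRanked.IsModel G := by
  refine ⟨fun τ hτ I hI => ?_, fun δ hδ => RankedInterp.satDef_iff.2 fun I hI => ?_⟩
  · obtain ⟨i, -, h⟩ := exists_respectsLevel hI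
    exact h.1 τ hτ
  · obtain ⟨i, hi, hIi, hIδ⟩ := mem_minFalsifying_iff.1 hI
    -- It remains to see that `δ` survives to level `i`: its subject is derivably empty at every
    -- earlier level.
    refine (hIi.2 δ ?_).resolve_left hIδ
    clear hIi
    induction i with
    | zero => exact hδ
    | succ i ih =>
      rw [level_succ, mem_nextLevel]
      exact ⟨ih fun k hk => hi k (hk.trans (Nat.lt_succ_self i)), hi i (Nat.lt_succ_self i)⟩

/-- A member of level `i + 1` has a subject derivably empty at level `i`, hence empty in all
interpretations of rank at most `i`. One of rank at most `i + 1` where the subject is nonempty is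
thus of least rank among such, and the ranked model forces the triple there. -/
theorem respectsLevel_of_rank_le {R : G.Ranked} (hR : R.IsModel G) (i : ℕ) :
    ∀ I, R.rank I ≤ i → G.RespectsLevel I i := by
  induction i with
  | zero =>
    intro I hI
    have hI0 : R.rank I = 0 := by simpa using hI
    have htop : R.rank I ≠ ⊤ := by simp [hI0]
    refine ⟨fun τ hτ => hR.1 τ hτ I htop, fun δ hδ => or_iff_not_imp_left.2 fun h => ?_⟩
    refine RankedInterp.satDef_iff.1 (hR.2 δ hδ) I ⟨htop, h, ?_⟩
    rintro ⟨J, -, -, hlt⟩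
    simp [hI0] at hlt
  | succ i ih =>
    intro I hI
    have htop : R.rank I ≠ ⊤ := ne_top_of_le_ne_top (ENat.natCast_ne_top _) hI
    refine ⟨fun τ hτ => hR.1 τ hτ I htop, fun δ hδ => or_iff_not_imp_left.2 fun h => ?_⟩
    have hδ₀ : δ ∈ G.dft := level_antitone (Nat.zero_le _) hδ
    refine RankedInterp.satDef_iff.1 (hR.2 δ hδ₀) I ⟨htop, h, ?_⟩
    rintro ⟨J, hJ, hJδ, hlt⟩
    rw [level_succ, mem_nextLevel] at hδ
    refine hJδ (cl_empty_iff.1 hδ.2 J (ih J ?_))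
    have := hlt.trans_le hI
    rw [Nat.cast_succ] at this
    exact Order.le_of_lt_add_one this

theorem minRanked_le {R : G.Ranked} (hR : R.IsModel G) : G.minRanked.Le R := by
  intro I
  by_cases h : R.rank I = ⊤
  · rw [h]; exact le_top
  · obtain ⟨i, hi⟩ := ENat.ne_top_iff_exists.1 h
    rw [← hi]
    exact minRank_le_iff.2 (respectsLevel_of_rank_le hR i I hi.symm.le)

/-- `minRanked` is least, not merely minimal, which yields uniqueness by antisymmetry. -/
theorem minModels_eq : G.minModels = {G.minRanked} := by
  ext R
  constructor
  · rintro ⟨hR, hmin⟩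
    have hle := minRanked_le hR
    by_contra hne
    exact hmin ⟨G.minRanked, minRanked_isModel, hle, fun h => hne (h.antisymm hle)⟩
  · rintro rfl
    exact ⟨minRanked_isModel, fun ⟨R', hR', hlt⟩ => hlt.2 (minRanked_le hR')⟩

theorem minEntails_iff {δ : DTriple U P T} : G.MinEntails δ ↔ G.minRanked.SatDef δ := by
  constructor
  · rintro ⟨R, hR, h⟩
    rw [minModels_eq, Set.singleton_eq_singleton_iff] at hR
    rwa [hR]
  · exact fun h => ⟨_, minModels_eq, h⟩

end DGraph

/-! ## The decision procedure -/

open Classical in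
/-- The defeasible `sp`-triples of `L` that are not exceptional. -/
noncomputable def unexceptionalP (S : Finset (Triple U P T)) (L : Finset (DTriple U P T)) :
    Finset (DTriple U P T) :=
  {δ ∈ L \ nextLevel S L | δ.kind = .sp}

theorem unexceptionalP_subset (S : Finset (Triple U P T)) (L : Finset (DTriple U P T)) :
    unexceptionalP S L ⊆ L := by
  classical
  exact (Finset.filter_subset _ _).trans Finset.sdiff_subset

/-- A derived `sp`-triple comes from a chain of given `sp`-triples. If some link is exceptional, its
subject is derivably empty, and emptiness moves back along the chain to `p`. -/
theorem cl_sp_unexceptionalP {S : Finset (Triple U P T)} {L : Finset (DTriple U P T)}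
    {τ : Triple U P T} (h : Cl (withStrict S L) τ) :
    ∀ p q, τ = tri p .sp q → Cl (withStrict S L) (tri p .botp p) ∨
      Cl (withStrict S (unexceptionalP S L)) τ := by
  classical
  induction h with
  | base h =>
    rintro p q rfl
    obtain h | ⟨⟨s, k, o⟩, hδ, e⟩ := h
    · exact .inr (.base (.inl h))
    · cases k
      · simp [DTriple.strict] at e
      · obtain ⟨rfl, rfl⟩ : p = s ∧ q = o := by simpa [DTriple.strict] using e
        by_cases hn : (⟨p, .sp, q⟩ : DTriple U P T) ∈ nextLevel S L
        · exact .inl (mem_nextLevel.1 hn).2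
        · exact .inr (.base (.inr ⟨_, by simp [unexceptionalP, hδ, hn], e⟩))
  | rule hR _ ih =>
    rintro p q rfl
    cases hR with
    | sp_trans A B C =>
      obtain h₁ | h₁ := ih _ (.inl rfl) _ _ rfl
      · exact .inl h₁
      · obtain h₂ | h₂ := ih _ (.inr rfl) _ _ rfl
        · have h₁' := h₁.mono (withStrict_mono (unexceptionalP_subset S L))
          exact .inl (.rule₂ (.botp_sp _ _ _)
            (.rule₁ (.botp_symm _ _) (.rule₂ (.botp_sp _ _ _) h₂ h₁')) h₁')
        · exact .inr (.rule₂ (.sp_trans _ _ _) h₁ h₂)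

/-- The list of levels is never empty, so the default is irrelevant here, and the head of the
remaining list is the next level. -/
theorem rankingLoop_levels_headD (S : Finset (Triple U P T)) (L X : Finset (DTriple U P T)) :
    (rankingLoop S L).levels.headD X = L := by
  rw [rankingLoop]
  split_ifs <;> rfl

/-- Quantifying over all `i` also covers the answer true when no suitable level exists. Levels past
the stopping point repeat the last one, so they add no condition. Before that point the levels
strictly shrink, whence induction on cardinality. -/
theorem defMinEntailmentLoop_iff (S : Finset (Triple U P T)) (p q : Name U P T)
    (L : Finset (DTriple U P T)) :
    defMinEntailmentLoop S (rankingLoop S L).top p q (rankingLoop S L).levels = true ↔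
      ∀ i, (∀ k < i, Cl (withStrict S (level S L k)) (tri p .botp p)) →
        ¬ Cl (withStrict S (level S L i)) (tri p .botp p) →
        Cl (withStrict S (unexceptionalP S (level S L i))) (tri p .sp q) := by
  classical
  induction hn : L.card using Nat.strong_induction_on generalizing L with
  | _ n ih =>
  subst hn
  rw [rankingLoop]
  by_cases hL : nextLevel S L = L
  · rw [if_pos hL]
    -- At the last level the default `top` takes the place of the next level; here it is `nextLevel
    -- S L`.
    simp only [defMinEntailmentLoop, derives_singleton_iff, List.headD_nil]
    simp only [level_of_fixed hL]
    split_ifs with h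
    · simp [h]
    · simp only [decide_eq_true_eq]
      exact ⟨fun h' _ _ _ => h', fun h' => h' 0 (by simp) h⟩
  · rw [if_neg hL]
    simp only [defMinEntailmentLoop, derives_singleton_iff, rankingLoop_levels_headD]
    split_ifs with h
    · rw [ih _ (Finset.card_lt_card (lt_of_le_of_ne (nextLevel_subset S L) hL)) _ rfl]
      constructor
      · intro H i hi hi'
        cases i with
        | zero => exact absurd h hi'
        | succ i =>
          rw [level_succ'] at hi' ⊢
          refine H i (fun k hk => ?_) hi'
          rw [← level_succ']
          exact hi _ (Nat.succ_lt_succ hk)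
      · intro H i hi hi'
        rw [← level_succ'] at hi' ⊢
        refine H (i + 1) (fun k hk => ?_) hi'
        cases k with
        | zero => exact h
        | succ k =>
          rw [level_succ']
          exact hi k (Nat.lt_of_succ_lt_succ hk)
    · simp only [decide_eq_true_eq]
      constructor
      · intro H i hi hi'
        cases i with
        | zero => exact H
        | succ i => exact absurd (hi 0 i.succ_pos) h
      · exact fun H => H 0 (fun k hk => absurd hk (Nat.not_lt_zero k)) h

/-- Both sides of the equivalence amount to a condition on the first level at which the emptiness
of `p` is not derivable. -/
theorem DGraph.minEntails_sp_iff (G : DGraph U P T) (p q : Name U P T) :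
    G.MinEntails ⟨p, .sp, q⟩ ↔
      ∀ i, (∀ k < i, Cl (withStrict G.str (level G.str G.dft k)) (tri p .botp p)) →
        ¬ Cl (withStrict G.str (level G.str G.dft i)) (tri p .botp p) →
        Cl (withStrict G.str (unexceptionalP G.str (level G.str G.dft i))) (tri p .sp q) := by
  rw [minEntails_iff, RankedInterp.satDef_iff]
  constructor
  · intro H i hi hi'
    -- The canonical interpretation of level `i` is a least one with `p` nonempty, and it satisfies
    -- only derivable `sp`-triples.
    have hsat : (G.levelInterp i).Sat (tri p .sp q) :=
      H _ (mem_minFalsifying_iff.2 ⟨i, hi, levelInterp_respectsLevel i, fun h =>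
        hi' (cl_empty_of_canonicalInterp_sat (δ := ⟨p, .sp, q⟩) h)⟩)
    exact (cl_sp_unexceptionalP (cl_sp_of_canonicalInterp_sat hsat) p q rfl).resolve_left hi'
  · intro H I hI
    obtain ⟨i, hi, hIi, hIp⟩ := mem_minFalsifying_iff.1 hI
    -- Emptiness of `p` cannot be derivable at level `i`, since `I` respects that level and refutes
    -- it.
    have hcl := H i hi fun h => hIp (cl_empty_iff.1 h I hIi)
    exact (Interp.Respects.sat_sp hIi
      (hcl.mono (withStrict_mono (unexceptionalP_subset _ _)))).resolve_right hIp

end RhoDf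

theorem mainTheorem8 {U : Type*} {P : Type*} {T : Type*} (G : RhoDf.DGraph U P T)
    (p q : RhoDf.Name U P T) :
    G.MinEntails ⟨p, .sp, q⟩ ↔
      RhoDf.defMinEntailmentP G (RhoDf.ranking G) p q = true := by
  rw [G.minEntails_sp_iff]
  exact (RhoDf.defMinEntailmentLoop_iff G.str p q G.dft).symm
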